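/- Let $n\ge 2$ and let $\mu$ be a Borel probability measure on $\mathbb{R}^n$ that is absolutely continuous with respect to Lebesgue measure. For a vector $v\in\mathbb{R}^n\setminus\{0\}$ and $\lambda\in\mathbb{R}$, the oriented hyperplane $H=H_{v,\lambda}=\{x\in\mathbb{R}^n:\langle x,v\rangle=\lambda\}$ has the closed half-spaces $H^+=\{x\in\mathbb{R}^n:\langle x,v\rangle\ge\lambda\}$ and $H^-=\{x\in\mathbb{R}^n:\langle x,v\rangle\le\lambda\}$. Then for all $\alpha_1,\alpha_2,\alpha_3,\alpha_4\in(0,1)$ with $\alpha_1+\alpha_2+\alpha_3+\alpha_4=1$ there exist two oriented hyperplanes $H_1,H_2$ in $\mathbb{R}^n$ such that $$\mu(H_1^+\cap H_2^+)=\alpha_1,\quad \mu(H_1^-\cap H_2^+)=\alpha_2,\quad \mu(H_1^+\cap H_2^-)=\alpha_3,\quad \mu(H_1^-\cap H_2^-)=\alpha_4.$$ -/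

import Mathlib

open MeasureTheory

/-- An oriented hyperplane `{x | ⟪x, v⟫ = c}` in `ℝⁿ`, given by a nonzero normal vector `v`
and a scalar `c`. -/
structure OrientedHyperplane (n : ℕ) where
  normal : EuclideanSpace ℝ (Fin n)
  offset : ℝ
  normal_ne_zero : normal ≠ 0

namespace OrientedHyperplane

/-- The closed half-space in the direction of the normal vector. -/
def pos {n : ℕ} (H : OrientedHyperplane n) : Set (EuclideanSpace ℝ (Fin n)) :=
  {x | inner ℝ x H.normal ≥ H.offset}

/-- The closed half-space in the direction of the reverse normal vector. -/
def neg {n : ℕ} (H : OrientedHyperplane n) : Set (EuclideanSpace ℝ (Fin n)) :=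
  {x | inner ℝ x H.normal ≤ H.offset}

end OrientedHyperplane

section Halfspaces

open Filter Topology

variable {E : Type*} [NormedAddCommGroup E] [InnerProductSpace ℝ E] [MeasurableSpace E]
  [BorelSpace E]

/-! Fix a half-space of mass `α₁ + α₂` and turn a second one, always of mass `α₁ + α₃`, through a
half turn in a plane. Parallel normals make the two nested, so they share at least `α₁`; opposite
normals make them disjoint or covering, so they share at most `α₁`. The intermediate value theorem
gives exactly `α₁`, and additivity across null hyperplanes gives the other three masses. The offset
of given mass may be non-unique and jump; `continuous_measureReal_halfspace_inter_of_eq` shows that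
the shared mass is continuous anyway. -/

theorem measurableSet_le_inner (v : E) (c : ℝ) : MeasurableSet {x : E | c ≤ inner ℝ x v} :=
  (isClosed_le continuous_const (by fun_prop)).measurableSet

theorem measurableSet_inner_le (v : E) (c : ℝ) : MeasurableSet {x : E | inner ℝ x v ≤ c} :=
  (isClosed_le (by fun_prop) continuous_const).measurableSet

theorem addHaar_setOf_inner_eq [FiniteDimensional ℝ E] (ν : Measure E) [ν.IsAddHaarMeasure]
    {v : E} (hv : v ≠ 0) (c : ℝ) : ν {x : E | inner ℝ x v = c} = 0 := by
  obtain h | ⟨x₀, hx₀⟩ := Set.eq_empty_or_nonempty {x : E | inner ℝ x v = c}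
  · rw [h, measure_empty]
  have hset : {x : E | inner ℝ x v = c} = (AffineSubspace.mk' x₀ (ℝ ∙ v)ᗮ : Set E) := by
    ext x
    have hx₀' : inner ℝ x₀ v = c := hx₀
    simp [AffineSubspace.mem_mk', Submodule.mem_orthogonal_singleton_iff_inner_left,
      inner_sub_left, sub_eq_zero, hx₀']
  rw [hset]
  -- Were the hyperplane the whole space, `v` would be orthogonal to itself.
  refine Measure.addHaar_affineSubspace ν _ fun htop => hv ?_
  have hmem : x₀ + v ∈ AffineSubspace.mk' x₀ (ℝ ∙ v)ᗮ := htop ▸ AffineSubspace.mem_top ℝ E _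
  simpa [AffineSubspace.mem_mk', Submodule.mem_orthogonal_singleton_iff_inner_left] using hmem

variable {μ : Measure E}

/-- If hyperplanes are null, the mass of a half-space inside a fixed measurable set depends
continuously on its normal and offset. -/
theorem tendsto_measureReal_halfspace_inter [IsFiniteMeasure μ] {A : Set E}
    (hA : MeasurableSet A) {ι : Type*} {l : Filter ι} [l.IsCountablyGenerated]
    {v : ι → E} {c : ι → ℝ} {v₀ : E} {c₀ : ℝ} (hnull : μ {x : E | inner ℝ x v₀ = c₀} = 0)
    (hv : Tendsto v l (𝓝 v₀)) (hc : Tendsto c l (𝓝 c₀)) :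
    Tendsto (fun i => μ.real ({x : E | c i ≤ inner ℝ x (v i)} ∩ A)) l
      (𝓝 (μ.real ({x : E | c₀ ≤ inner ℝ x v₀} ∩ A))) := by
  refine (ENNReal.tendsto_toReal (measure_ne_top μ _)).comp ?_
  refine tendsto_measure_of_ae_tendsto_indicator_of_isFiniteMeasure l
    ((measurableSet_le_inner _ _).inter hA) (fun i => (measurableSet_le_inner _ _).inter hA) ?_
  -- Off the limiting hyperplane, membership in the moving half-space is eventually constant.
  have hae : ∀ᵐ x ∂μ, inner ℝ x v₀ ≠ c₀ := by simpa [ae_iff] using hnull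
  filter_upwards [hae] with x hx
  have hx' : Tendsto (fun i => inner ℝ x (v i)) l (𝓝 (inner ℝ x v₀)) :=
    tendsto_const_nhds.inner hv
  rcases lt_or_gt_of_ne hx with h | h
  · filter_upwards [hx'.eventually_lt hc h] with i hi
    simp [not_le.2 hi, not_le.2 h]
  · filter_upwards [hc.eventually_lt hx' h] with i hi
    simp [hi.le, h.le]

theorem tendsto_measureReal_halfspace [IsFiniteMeasure μ] {ι : Type*} {l : Filter ι}
    [l.IsCountablyGenerated] {v : ι → E} {c : ι → ℝ} {v₀ : E} {c₀ : ℝ}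
    (hnull : μ {x : E | inner ℝ x v₀ = c₀} = 0)
    (hv : Tendsto v l (𝓝 v₀)) (hc : Tendsto c l (𝓝 c₀)) :
    Tendsto (fun i => μ.real {x : E | c i ≤ inner ℝ x (v i)}) l
      (𝓝 (μ.real {x : E | c₀ ≤ inner ℝ x v₀})) := by
  simpa using tendsto_measureReal_halfspace_inter MeasurableSet.univ hnull hv hc

theorem measureReal_inner_le_add_le_inner [IsProbabilityMeasure μ] {v : E} {c : ℝ}
    (hnull : μ {x : E | inner ℝ x v = c} = 0) {A : Set E} (hA : MeasurableSet A) :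
    μ.real ({x : E | inner ℝ x v ≤ c} ∩ A) + μ.real ({x : E | c ≤ inner ℝ x v} ∩ A)
      = μ.real A := by
  have hd : AEDisjoint μ ({x : E | inner ℝ x v ≤ c} ∩ A) ({x : E | c ≤ inner ℝ x v} ∩ A) :=
    measure_mono_null (fun x hx => le_antisymm hx.1.1 hx.2.1) hnull
  rw [← measureReal_union₀ ((measurableSet_le_inner v c).inter hA).nullMeasurableSet hd,
    ← Set.union_inter_distrib_right]
  congr 1
  ext x
  simp [le_total]

theorem exists_measureReal_halfspace_eq [IsProbabilityMeasure μ] {v : E}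
    (hnull : ∀ c : ℝ, μ {x : E | inner ℝ x v = c} = 0) {p : ℝ} (hp : p ∈ Set.Ioo (0 : ℝ) 1) :
    ∃ c : ℝ, μ.real {x : E | c ≤ inner ℝ x v} = p := by
  have hmeas : Measurable fun x : E => (inner ℝ x v : ℝ) :=
    (by fun_prop : Continuous fun x : E => (inner ℝ x v : ℝ)).measurable
  have : IsProbabilityMeasure (μ.map fun x : E => (inner ℝ x v : ℝ)) :=
    Measure.isProbabilityMeasure_map hmeas.aemeasurable
  have hcdf (c : ℝ) : μ.real {x : E | c ≤ inner ℝ x v}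
      = 1 - ProbabilityTheory.cdf (μ.map fun x : E => (inner ℝ x v : ℝ)) c := by
    have h := measureReal_inner_le_add_le_inner (hnull c) MeasurableSet.univ
    simp only [Set.inter_univ, probReal_univ] at h
    rw [ProbabilityTheory.cdf_eq_real, map_measureReal_apply hmeas measurableSet_Iic]
    exact eq_sub_of_add_eq' h
  refine mem_range_of_exists_le_of_exists_ge
    (f := fun c : ℝ => μ.real {x : E | c ≤ inner ℝ x v}) ?_ ?_ ?_
  · exact continuous_iff_continuousAt.2 fun c =>
      tendsto_measureReal_halfspace (hnull c) tendsto_const_nhds tendsto_id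
  · obtain ⟨c, hc⟩ := ((ProbabilityTheory.tendsto_cdf_atTop _).eventually_const_lt
      (by linarith [hp.1] : 1 - p < 1)).exists
    exact ⟨c, by rw [hcdf]; linarith⟩
  · obtain ⟨c, hc⟩ := ((ProbabilityTheory.tendsto_cdf_atBot _).eventually_lt_const
      (by linarith [hp.2] : 0 < 1 - p)).exists
    exact ⟨c, by rw [hcdf]; linarith⟩

/-- Along a path of normals, the half-spaces of constant mass cut out of a fixed set a mass that
varies continuously, even though their offsets need not. -/
theorem continuous_measureReal_halfspace_inter_of_eq [IsFiniteMeasure μ]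
    {v : ℝ → E} (hv : Continuous v) {c : ℝ → ℝ}
    (hnull : ∀ (t d : ℝ), μ {x : E | inner ℝ x (v t) = d} = 0) {p : ℝ}
    (hc : ∀ t, μ.real {x : E | c t ≤ inner ℝ x (v t)} = p) {A : Set E} (hA : MeasurableSet A) :
    Continuous fun t => μ.real ({x : E | c t ≤ inner ℝ x (v t)} ∩ A) := by
  have hnested (w : E) {a b : ℝ} (hab : a ≤ b) :
      {x : E | b ≤ inner ℝ x w} ⊆ {x : E | a ≤ inner ℝ x w} := fun x hx => hab.trans hx
  -- The slab between two parallel hyperplanes has no more mass inside `A` than in total.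
  have mono (w : E) {a b : ℝ} (hab : a ≤ b) :
      |μ.real ({x : E | b ≤ inner ℝ x w} ∩ A) - μ.real ({x : E | a ≤ inner ℝ x w} ∩ A)|
        ≤ |μ.real {x : E | b ≤ inner ℝ x w} - μ.real {x : E | a ≤ inner ℝ x w}| := by
    have h₁ := measureReal_inter_add_sdiff (μ := μ) (s := {x : E | a ≤ inner ℝ x w}) hA
    have h₂ := measureReal_inter_add_sdiff (μ := μ) (s := {x : E | b ≤ inner ℝ x w}) hA
    have h₃ : μ.real ({x : E | b ≤ inner ℝ x w} ∩ A) ≤ μ.real ({x : E | a ≤ inner ℝ x w} ∩ A) :=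
      measureReal_mono (Set.inter_subset_inter_left _ (hnested w hab))
    have h₄ : μ.real ({x : E | b ≤ inner ℝ x w} \ A) ≤ μ.real ({x : E | a ≤ inner ℝ x w} \ A) :=
      measureReal_mono (Set.sdiff_subset_sdiff_left (hnested w hab))
    rw [abs_of_nonpos (by linarith), abs_of_nonpos (by linarith)]
    linarith
  have key (w : E) (a b : ℝ) :
      |μ.real ({x : E | b ≤ inner ℝ x w} ∩ A) - μ.real ({x : E | a ≤ inner ℝ x w} ∩ A)|
        ≤ |μ.real {x : E | b ≤ inner ℝ x w} - μ.real {x : E | a ≤ inner ℝ x w}| := by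
    rcases le_total a b with h | h
    · exact mono w h
    · rw [abs_sub_comm, abs_sub_comm (μ.real {x : E | b ≤ inner ℝ x w})]
      exact mono w h
  refine continuous_iff_continuousAt.2 fun t₀ => ?_
  have hlim := tendsto_measureReal_halfspace_inter hA (hnull t₀ (c t₀)) hv.continuousAt
    (tendsto_const_nhds (x := c t₀))
  have hmass := tendsto_measureReal_halfspace (hnull t₀ (c t₀)) hv.continuousAt
    (tendsto_const_nhds (x := c t₀))
  -- Freezing the offset at `c t₀` costs at most the change in total mass, which tends to `p - p =
  -- 0`.
  have hzero : Tendsto (fun t => μ.real ({x : E | c t ≤ inner ℝ x (v t)} ∩ A)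
      - μ.real ({x : E | c t₀ ≤ inner ℝ x (v t)} ∩ A)) (𝓝 t₀) (𝓝 0) := by
    refine squeeze_zero_norm (fun t => key (v t) (c t₀) (c t)) ?_
    simpa [hc] using (hmass.const_sub p).abs
  simpa [ContinuousAt] using hzero.add hlim

/-- Two half-spaces with prescribed masses `p`, `q` can be chosen with any intersection mass
strictly between the extremes attained by parallel half-spaces. -/
theorem exists_halfspaces_measureReal_inter_eq [IsProbabilityMeasure μ]
    (hnull : ∀ v : E, v ≠ 0 → ∀ c : ℝ, μ {x : E | inner ℝ x v = c} = 0)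
    {e f : E} (hef : LinearIndependent ℝ ![e, f]) {p q r : ℝ} (hp : p ∈ Set.Ioo (0 : ℝ) 1)
    (hq : q ∈ Set.Ioo (0 : ℝ) 1) (hr₀ : 0 ≤ r) (hr : p + q - 1 ≤ r) (hrp : r ≤ p)
    (hrq : r ≤ q) :
    ∃ (v w : E) (c d : ℝ), v ≠ 0 ∧ w ≠ 0 ∧ μ.real {x : E | c ≤ inner ℝ x v} = p ∧
      μ.real {x : E | d ≤ inner ℝ x w} = q ∧
      μ.real ({x : E | c ≤ inner ℝ x v} ∩ {x : E | d ≤ inner ℝ x w}) = r := by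
  have he : e ≠ 0 := hef.ne_zero 0
  let v : ℝ → E := fun t => Real.cos t • e + Real.sin t • f
  have hv₀ (t : ℝ) : v t ≠ 0 := fun h => by
    obtain ⟨h₁, h₂⟩ := LinearIndependent.pair_iff.1 hef _ _ h
    simpa [h₁, h₂] using Real.cos_sq_add_sin_sq t
  have hv : Continuous v := by fun_prop
  obtain ⟨d, hd⟩ := exists_measureReal_halfspace_eq (hnull e he) hq
  choose c hc using fun t => exists_measureReal_halfspace_eq (hnull (v t) (hv₀ t)) hp
  have hcont := continuous_measureReal_halfspace_inter_of_eq hv (fun t => hnull _ (hv₀ t)) hc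
    (measurableSet_le_inner e d)
  suffices h : r ∈ Set.range fun t => μ.real ({x : E | c t ≤ inner ℝ x (v t)} ∩
      {x : E | d ≤ inner ℝ x e}) by
    obtain ⟨t, ht⟩ := h
    exact ⟨v t, e, c t, d, hv₀ t, he, hc t, hd, ht⟩
  -- The normals are opposite at `π` and equal at `0`.
  refine mem_range_of_exists_le_of_exists_ge hcont ⟨Real.pi, ?_⟩ ⟨0, ?_⟩
  · have hpi := hc Real.pi
    have hvpi : v Real.pi = -e := by simp [v]
    rw [hvpi] at hpi ⊢
    rcases lt_or_ge (-c Real.pi) d with h | h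
    · have hempty : {x : E | c Real.pi ≤ inner ℝ x (-e)} ∩ {x : E | d ≤ inner ℝ x e} = ∅ := by
        ext x
        simp only [inner_neg_right, Set.mem_inter_iff, Set.mem_ofPred_eq, Set.mem_empty_iff_false,
          iff_false, not_and, not_le]
        intro h'
        linarith
      rw [hempty, measureReal_empty]
      exact hr₀
    · have huniv : {x : E | c Real.pi ≤ inner ℝ x (-e)} ∪ {x : E | d ≤ inner ℝ x e}
          = Set.univ := by
        ext x
        simp only [inner_neg_right, Set.mem_union, Set.mem_ofPred_eq, Set.mem_univ, iff_true]
        by_contra! h'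
        linarith
      have h' := measureReal_union_add_inter (μ := μ) (s := {x : E | c Real.pi ≤ inner ℝ x (-e)})
        (measurableSet_le_inner e d)
      rw [huniv, probReal_univ, hpi, hd] at h'
      linarith
  · have hzero := hc 0
    have hv0 : v 0 = e := by simp [v]
    rw [hv0] at hzero ⊢
    rcases le_total (c 0) d with h | h
    · have hsub : {x : E | d ≤ inner ℝ x e} ⊆ {x : E | c 0 ≤ inner ℝ x e} :=
        fun x hx => h.trans hx
      rw [Set.inter_eq_self_of_subset_right hsub, hd]
      exact hrq
    · have hsub : {x : E | c 0 ≤ inner ℝ x e} ⊆ {x : E | d ≤ inner ℝ x e} :=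
        fun x hx => h.trans hx
      rw [Set.inter_eq_self_of_subset_left hsub, hzero]
      exact hrp

end Halfspaces

theorem mainTheorem5 (n : ℕ) (hn : 2 ≤ n)
    (μ : Measure (EuclideanSpace ℝ (Fin n))) [IsProbabilityMeasure μ]
    (hμ : μ ≪ (volume : Measure (EuclideanSpace ℝ (Fin n))))
    (α₁ α₂ α₃ α₄ : ℝ)
    (h₁ : α₁ ∈ Set.Ioo (0 : ℝ) 1) (h₂ : α₂ ∈ Set.Ioo (0 : ℝ) 1)
    (h₃ : α₃ ∈ Set.Ioo (0 : ℝ) 1) (h₄ : α₄ ∈ Set.Ioo (0 : ℝ) 1)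
    (hsum : α₁ + α₂ + α₃ + α₄ = 1) :
    ∃ H₁ H₂ : OrientedHyperplane n,
      μ (H₁.pos ∩ H₂.pos) = ENNReal.ofReal α₁ ∧
      μ (H₁.neg ∩ H₂.pos) = ENNReal.ofReal α₂ ∧
      μ (H₁.pos ∩ H₂.neg) = ENNReal.ofReal α₃ ∧
      μ (H₁.neg ∩ H₂.neg) = ENNReal.ofReal α₄ := by
  simp only [Set.mem_Ioo] at h₁ h₂ h₃ h₄
  have hnull (v : EuclideanSpace ℝ (Fin n)) (hv : v ≠ 0) (c : ℝ) :
      μ {x | inner ℝ x v = c} = 0 := hμ (addHaar_setOf_inner_eq volume hv c)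
  have hef : LinearIndependent ℝ ![EuclideanSpace.single (⟨0, by omega⟩ : Fin n) (1 : ℝ),
      EuclideanSpace.single (⟨1, by omega⟩ : Fin n) (1 : ℝ)] := by
    refine LinearIndependent.pair_iff.2 fun s t hst => ⟨?_, ?_⟩
    · simpa using congrArg (fun x : EuclideanSpace ℝ (Fin n) => x ⟨0, by omega⟩) hst
    · simpa using congrArg (fun x : EuclideanSpace ℝ (Fin n) => x ⟨1, by omega⟩) hst
  -- Here `p + q - 1 = α₁ - α₄`, which is below `r = α₁`.
  obtain ⟨v, w, c, d, hv, hw, hp, hq, hr⟩ := exists_halfspaces_measureReal_inter_eq hnull hef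
    (p := α₁ + α₃) (q := α₁ + α₂) (r := α₁) ⟨by linarith, by linarith⟩
    ⟨by linarith, by linarith⟩ (by linarith) (by linarith) (by linarith) (by linarith)
  have hnp := measureReal_inner_le_add_le_inner (hnull v hv c) (measurableSet_le_inner w d)
  have hpn := measureReal_inner_le_add_le_inner (hnull w hw d) (measurableSet_le_inner v c)
  have hnn := measureReal_inner_le_add_le_inner (hnull v hv c) (measurableSet_inner_le w d)
  have hn' := measureReal_inner_le_add_le_inner (hnull w hw d) MeasurableSet.univ
  rw [Set.inter_comm, Set.inter_comm {x | d ≤ inner ℝ x w}] at hpn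
  simp only [Set.inter_univ, probReal_univ] at hn'
  have hofReal {s : Set (EuclideanSpace ℝ (Fin n))} {a : ℝ} (h : μ.real s = a) :
      μ s = ENNReal.ofReal a := by rw [← h, ofReal_measureReal]
  refine ⟨⟨v, c, hv⟩, ⟨w, d, hw⟩, hofReal hr, hofReal ?_, hofReal ?_, hofReal ?_⟩
  · change μ.real ({x | inner ℝ x v ≤ c} ∩ {x | d ≤ inner ℝ x w}) = α₂
    linarith
  · change μ.real ({x | c ≤ inner ℝ x v} ∩ {x | inner ℝ x w ≤ d}) = α₃
    linarith
  · change μ.real ({x | inner ℝ x v ≤ c} ∩ {x | inner ℝ x w ≤ d}) = α₄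
    linarith
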